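/- Let $L$ be a finite bounded distributive lattice with $0\neq 1$, with implication $r_1\to r_2=\bigvee\{\ell\in L: r_1\wedge\ell\le r_2\}$. For a non-empty partially ordered set $(W,R)$ (an intuitionistic Kripke frame), the *intuitionistic power* of $L$ with respect to $(W,R)$ is the algebra $(L^W,\vee,\wedge,\to,0,1)$, where $L^W$ is the set of order-preserving (persistent) maps $W\to L$, the operations $\vee,\wedge,0,1$ are pointwise, and $$(f\to g)(w)=\bigwedge\{f(w')\to g(w') : wRw'\}.$$ Let $ISP_I(L)$ be the category whose objects are all isomorphic copies of subalgebras of intuitionistic powers of $L$, and whose arrows are the maps preserving $\vee,\wedge,\to,0,1$. Let $HSpa$ be the following category. An object is a non-empty compact topological space $S$ with a partial order $R$ such that (a) whenever $x\not\mathrel{R}y$, there is a clopen up-set $W\subseteq S$ with $x\in W$ and $y\notin W$; and (b) for every clopen $U\subseteq S$, the set $R^{-1}(U)=\{y\in S : yRx \text{ for some } x\in U\}$ is a clopen down-set. An arrow $(S_1,R_1)\to(S_2,R_2)$ is a continuous order-preserving map $\phi$ such that, whenever $\phi(s_1)R_2s_2$, there is $s\in S_1$ with $s_1R_1s$ and $\phi(s)=s_2$.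 **Theorem.** The category $ISP_I(L)$ is dually equivalent to the category $HSpa$; that is, $ISP_I(L)^{\mathrm{op}}$ and $HSpa$ are equivalent categories. -/

import Mathlib

open CategoryTheory

universe u v

/-! ### Algebras with operations `⊔, ⊓, ⇨, ⊤, ⊥` -/

/-- Algebras of the signature `(∨, ∧, →, 1, 0)`; no identities are required. -/
class ImpAlg (A : Type u) extends Max A, Min A, HImp A, Top A, Bot A

/-- Maps preserving all five operations. -/
@[ext]
structure ImpAlgHom (A : Type u) (B : Type v) [ImpAlg A] [ImpAlg B] where
  toFun : A → B
  map_sup : ∀ a b, toFun (a ⊔ b) = toFun a ⊔ toFun b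
  map_inf : ∀ a b, toFun (a ⊓ b) = toFun a ⊓ toFun b
  map_himp : ∀ a b, toFun (a ⇨ b) = toFun a ⇨ toFun b
  map_top : toFun ⊤ = ⊤
  map_bot : toFun ⊥ = ⊥

namespace ImpAlgHom

/-- The identity homomorphism. -/
def id (A : Type u) [ImpAlg A] : ImpAlgHom A A where
  toFun a := a
  map_sup _ _ := rfl
  map_inf _ _ := rfl
  map_himp _ _ := rfl
  map_top := rfl
  map_bot := rfl

/-- Composition of homomorphisms. -/
def comp {A B C : Type u} [ImpAlg A] [ImpAlg B] [ImpAlg C]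
    (g : ImpAlgHom B C) (f : ImpAlgHom A B) : ImpAlgHom A C where
  toFun a := g.toFun (f.toFun a)
  map_sup a b := by rw [f.map_sup, g.map_sup]
  map_inf a b := by rw [f.map_inf, g.map_inf]
  map_himp a b := by rw [f.map_himp, g.map_himp]
  map_top := by rw [f.map_top, g.map_top]
  map_bot := by rw [f.map_bot, g.map_bot]

end ImpAlgHom

/-- Subalgebras: subsets closed under all five operations. -/
structure ImpSubalg (A : Type u) [ImpAlg A] where
  carrier : Set A
  sup_mem : ∀ {a b}, a ∈ carrier → b ∈ carrier → a ⊔ b ∈ carrier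
  inf_mem : ∀ {a b}, a ∈ carrier → b ∈ carrier → a ⊓ b ∈ carrier
  himp_mem : ∀ {a b}, a ∈ carrier → b ∈ carrier → a ⇨ b ∈ carrier
  top_mem : ⊤ ∈ carrier
  bot_mem : ⊥ ∈ carrier

/-- A subalgebra with the restricted operations. -/
instance ImpSubalg.instImpAlg {A : Type u} [ImpAlg A] (B : ImpSubalg A) :
    ImpAlg B.carrier where
  max a b := ⟨a.1 ⊔ b.1, B.sup_mem a.2 b.2⟩
  min a b := ⟨a.1 ⊓ b.1, B.inf_mem a.2 b.2⟩
  himp a b := ⟨a.1 ⇨ b.1, B.himp_mem a.2 b.2⟩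
  top := ⟨⊤, B.top_mem⟩
  bot := ⟨⊥, B.bot_mem⟩

/-! ### Intuitionistic powers -/

section FiniteLattice

variable {L : Type v} [DistribLattice L] [BoundedOrder L] [Finite L]

/-- The join of a subset of the finite lattice `L`. -/
noncomputable def finJoin (s : Set L) : L := s.toFinite.toFinset.sup (fun l => l)

/-- The meet of a subset of the finite lattice `L`. -/
noncomputable def finMeet (s : Set L) : L := s.toFinite.toFinset.inf (fun l => l)

theorem isLUB_finJoin (s : Set L) : IsLUB s (finJoin s) := by
  constructor
  · intro l hl
    exact Finset.le_sup (f := fun l : L => l) (s.toFinite.mem_toFinset.2 hl)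
  · intro b hb
    exact Finset.sup_le fun l hl => hb (s.toFinite.mem_toFinset.1 hl)

theorem isGLB_finMeet (s : Set L) : IsGLB s (finMeet s) := by
  constructor
  · intro l hl
    exact Finset.inf_le (f := fun l : L => l) (s.toFinite.mem_toFinset.2 hl)
  · intro b hb
    exact Finset.le_inf fun l hl => hb (s.toFinite.mem_toFinset.1 hl)

/-- The implication of `L`: the join of all `l` with `r₁ ∧ l ≤ r₂`. -/
noncomputable def finImp (r₁ r₂ : L) : L := finJoin {l | r₁ ⊓ l ≤ r₂}

end FiniteLattice

/-- The underlying set of the intuitionistic power of `L` with respect to the intuitionistic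
Kripke frame `(W, ≤)`: the persistent (that is, order preserving) valuations `W → L`. -/
structure IntPower (L : Type v) (W : Type u) [Preorder L] [PartialOrder W] where
  val : W → L
  mono : Monotone val

/-- The operations of the intuitionistic power: `∨, ∧, 1, 0` are pointwise, and
`(f → g)(w) = ⋀ {f w' → g w' | w ≤ w'}`. -/
noncomputable instance IntPower.instImpAlg (L : Type v) (W : Type u) [DistribLattice L]
    [BoundedOrder L] [Finite L] [PartialOrder W] : ImpAlg (IntPower L W) where
  max f g := ⟨fun w => f.val w ⊔ g.val w, fun _ _ h => sup_le_sup (f.mono h) (g.mono h)⟩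
  min f g := ⟨fun w => f.val w ⊓ g.val w, fun _ _ h => inf_le_inf (f.mono h) (g.mono h)⟩
  himp f g :=
    ⟨fun w => finMeet {l | ∃ w', w ≤ w' ∧ l = finImp (f.val w') (g.val w')}, by
      intro w₁ w₂ h
      refine (isGLB_finMeet _).2 ?_
      rintro l ⟨w', hw', rfl⟩
      exact (isGLB_finMeet _).1 ⟨w', h.trans hw', rfl⟩⟩
  top := ⟨fun _ => ⊤, fun _ _ _ => le_rfl⟩
  bot := ⟨fun _ => ⊥, fun _ _ _ => le_rfl⟩

/-! ### The category of algebras in `ISP_I(L)` -/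

/-- `A` is an isomorphic copy of a subalgebra of an intuitionistic power of `L`; the frame of an
intuitionistic power is a non-empty poset. -/
def IsISPI (L : Type v) [DistribLattice L] [BoundedOrder L] [Finite L]
    (A : Type u) [ImpAlg A] : Prop :=
  ∃ (W : Type u) (_ : PartialOrder W) (_ : Nonempty W) (B : ImpSubalg (IntPower L W))
    (e : ImpAlgHom A B.carrier), Function.Bijective e.toFun

/-- Objects of the category `ISP_I(L)`. -/
structure ISPI (L : Type v) [DistribLattice L] [BoundedOrder L] [Finite L] where
  carrier : Type u
  [alg : ImpAlg carrier]
  isISPI : IsISPI L carrier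

attribute [instance] ISPI.alg

/-- Arrows of `ISP_I(L)` are the maps preserving `∨, ∧, →, 1, 0`. -/
instance ISPI.instCategory (L : Type v) [DistribLattice L] [BoundedOrder L] [Finite L] :
    Category.{u} (ISPI.{u, v} L) where
  Hom A B := ImpAlgHom A.carrier B.carrier
  id A := ImpAlgHom.id A.carrier
  comp f g := ImpAlgHom.comp g f

/-! ### The category `HSpa` -/

/-- Objects of `PSpa`: (non-empty) compact spaces with a partial order such that `¬ x ≤ y`
implies that some clopen up-set contains `x` but not `y`. -/
structure PSpa where
  carrier : Type u
  [top : TopologicalSpace carrier]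
  [order : PartialOrder carrier]
  nonempty : Nonempty carrier
  compact : CompactSpace carrier
  separated : ∀ x y : carrier, ¬ x ≤ y →
    ∃ U : Set carrier, IsClopen U ∧ IsUpperSet U ∧ x ∈ U ∧ y ∉ U

attribute [instance] PSpa.top PSpa.order

/-- Objects of `HSpa`: objects of `PSpa` in which `R⁻¹(U) = {y | ∃ x ∈ U, y ≤ x}` is a clopen
down-set for every clopen `U`. -/
structure HSpa extends PSpa.{u} where
  clopen_down : ∀ U : Set carrier, IsClopen U →
    IsClopen {y | ∃ x ∈ U, y ≤ x} ∧ IsLowerSet {y | ∃ x ∈ U, y ≤ x}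

/-- Arrows `φ` of `HSpa` are the continuous order preserving maps such that `φ s₁ ≤ s₂` implies
`φ s = s₂` for some `s ≥ s₁`. -/
instance HSpa.instCategory : Category.{u} HSpa.{u} where
  Hom S T := EsakiaHom S.carrier T.carrier
  id S := EsakiaHom.id S.carrier
  comp f g := EsakiaHom.comp g f

/-! For nontrivial `L` the class `ISP_I(L)` does not depend on `L`: it consists of the nontrivial
Heyting algebras. Indeed the operations of an intuitionistic power satisfy the Heyting identities,
and conversely a Heyting algebra embeds into the intuitionistic power over its poset of prime
filters through indicator functions with values in `{⊥, ⊤}`; preservation of `→` is the prime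
filter theorem.

The theorem is thus Esakia duality. The functor of clopen upper sets is fully faithful since the
points of a compact Priestley space are the prime filters of its clopen upper sets, and a
homomorphism preserves `→` exactly when the map it induces on points lifts upward. It is
essentially surjective by the Stone map of the space of prime filters. -/

open Set TopologicalSpace

/-! ### Priestley spaces -/

section PriestleySpace

variable {α : Type*} [TopologicalSpace α]

instance closedIciTopology_of_priestleySpace [Preorder α] [PriestleySpace α] :
    ClosedIciTopology α where
  isClosed_Ici x := by
    refine isOpen_compl_iff.1 (isOpen_iff_mem_nhds.2 fun y hxy => ?_)
    obtain ⟨U, hU, hUu, hxU, hyU⟩ := exists_isClopen_upper_of_not_le hxy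
    exact Filter.mem_of_superset (hU.compl.isOpen.mem_nhds hyU) fun z hzU hxz =>
      hzU (hUu hxz hxU)

theorem le_of_forall_mem_clopenUpperSet [Preorder α] [PriestleySpace α] {x y : α}
    (h : ∀ U : ClopenUpperSet α, x ∈ U → y ∈ U) : x ≤ y := by
  by_contra hxy
  obtain ⟨U, hU, hUu, hx, hy⟩ := exists_isClopen_upper_of_not_le hxy
  exact hy (h ⟨⟨U, hU⟩, hUu⟩ hx)

theorem eq_of_forall_mem_clopenUpperSet_iff [PartialOrder α] [PriestleySpace α] {x y : α}
    (h : ∀ U : ClopenUpperSet α, x ∈ U ↔ y ∈ U) : x = y :=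
  le_antisymm (le_of_forall_mem_clopenUpperSet fun U => (h U).1)
    (le_of_forall_mem_clopenUpperSet fun U => (h U).2)

theorem surjective_of_forall_not_le_exists_mem [Preorder α] [CompactSpace α] {A : Type*}
    [Lattice A] [BoundedOrder A] (φ : BoundedLatticeHom A (ClopenUpperSet α))
    (hφ : ∀ x y : α, ¬x ≤ y → ∃ a, x ∈ φ a ∧ y ∉ φ a) : Function.Surjective φ := by
  intro U
  have exists_mem_subset : ∀ x ∈ U, ∃ a, x ∈ φ a ∧ φ a ≤ U := by
    intro x hx
    have : Nonempty {a // x ∈ φ a} := ⟨⊤, by rw [map_top]; trivial⟩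
    have directed : Directed (· ⊇ ·) fun a : {a // x ∈ φ a} => (φ a : Set α) := fun a b =>
      ⟨⟨a ⊓ b, by rw [map_inf]; exact ⟨a.2, b.2⟩⟩, OrderHomClass.mono φ inf_le_left,
        OrderHomClass.mono φ inf_le_right⟩
    obtain ⟨a, ha⟩ := exists_subset_nhds_of_compactSpace directed
      (fun a => (φ a).isClopen.isClosed) (U := U) fun y hy => U.isClopen.isOpen.mem_nhds <| by
        refine U.upper (by_contra fun hxy => ?_) hx
        obtain ⟨a, hxa, hya⟩ := hφ x y hxy
        exact hya (mem_iInter.1 hy ⟨a, hxa⟩)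
    exact ⟨a, a.2, ha⟩
  have : Nonempty {a // φ a ≤ U} := ⟨⊥, by simp⟩
  have directed : Directed (· ⊆ ·) fun a : {a // φ a ≤ U} => (φ a : Set α) := fun a b =>
    ⟨⟨a ⊔ b, by rw [map_sup]; exact sup_le a.2 b.2⟩, OrderHomClass.mono φ le_sup_left,
      OrderHomClass.mono φ le_sup_right⟩
  obtain ⟨a, ha⟩ := U.isClopen.isClosed.isCompact.elim_directed_cover _
    (fun a : {a // φ a ≤ U} => (φ a).isClopen.isOpen)
    (fun x hx =>
      let ⟨a, hxa, haU⟩ := exists_mem_subset x hx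
      mem_iUnion.2 ⟨⟨a, haU⟩, hxa⟩) directed
  exact ⟨a, le_antisymm a.2 ha⟩

end PriestleySpace

/-! ### The Priestley dual of a lattice -/

/-- The Priestley dual of a bounded lattice `A`: its prime filters, encoded by their characteristic
functions, with the inclusion order and the topology of pointwise convergence. -/
def PriestleyDual (A : Type u) [Lattice A] [BoundedOrder A] : Type u := BoundedLatticeHom A Bool

namespace PriestleyDual

section Lattice

variable {A : Type*} [Lattice A] [BoundedOrder A]

instance : FunLike (PriestleyDual A) A Bool :=
  inferInstanceAs (FunLike (BoundedLatticeHom A Bool) A Bool)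

instance : BoundedLatticeHomClass (PriestleyDual A) A Bool :=
  inferInstanceAs (BoundedLatticeHomClass (BoundedLatticeHom A Bool) A Bool)

instance : PartialOrder (PriestleyDual A) :=
  PartialOrder.lift (DFunLike.coe : PriestleyDual A → A → Bool) DFunLike.coe_injective

instance : TopologicalSpace (PriestleyDual A) :=
  .induced (DFunLike.coe : PriestleyDual A → A → Bool) inferInstance

theorem le_iff {p q : PriestleyDual A} : p ≤ q ↔ ∀ a, p a → q a :=
  forall_congr' fun _ => Bool.le_iff_imp

theorem apply_of_le (p : PriestleyDual A) {a b : A} (hab : a ≤ b) (ha : p a) : p b :=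
  Bool.le_iff_imp.1 (OrderHomClass.mono p hab) ha

theorem isClosed_range_coe : IsClosed (range (DFunLike.coe : PriestleyDual A → A → Bool)) := by
  have : ContinuousInf Bool := ⟨continuous_of_discreteTopology⟩
  have : ContinuousSup Bool := ⟨continuous_of_discreteTopology⟩
  have range_eq : range (DFunLike.coe : PriestleyDual A → A → Bool) =
      {f | f ⊤ = ⊤} ∩ {f | f ⊥ = ⊥} ∩ (⋂ (a) (b), {f | f (a ⊓ b) = f a ⊓ f b}) ∩
        ⋂ (a) (b), {f | f (a ⊔ b) = f a ⊔ f b} := by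
    ext f
    simp only [mem_inter_iff, mem_iInter]
    constructor
    · rintro ⟨p, rfl⟩
      exact ⟨⟨⟨map_top p, map_bot p⟩, map_inf p⟩, map_sup p⟩
    · rintro ⟨⟨⟨htop, hbot⟩, hinf⟩, hsup⟩
      exact ⟨(⟨⟨⟨f, hsup⟩, hinf⟩, htop, hbot⟩ : BoundedLatticeHom A Bool), rfl⟩
  rw [range_eq]
  refine (((isClosed_eq ?_ ?_).inter (isClosed_eq ?_ ?_)).inter
    (isClosed_iInter fun a => isClosed_iInter fun b => isClosed_eq ?_ ?_)).inter
    (isClosed_iInter fun a => isClosed_iInter fun b => isClosed_eq ?_ ?_) <;> fun_prop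

instance : CompactSpace (PriestleyDual A) :=
  Topology.IsClosedEmbedding.compactSpace
    (f := (DFunLike.coe : PriestleyDual A → A → Bool))
    ⟨⟨⟨rfl⟩, DFunLike.coe_injective⟩, isClosed_range_coe⟩

theorem continuous_apply (a : A) : Continuous fun p : PriestleyDual A => p a :=
  (_root_.continuous_apply a).comp continuous_induced_dom

/-- The Stone map, sending `a` to the set of prime filters containing `a`. -/
def basicClopen : BoundedLatticeHom A (ClopenUpperSet (PriestleyDual A)) where
  toFun a :=
    { carrier := {p | p a}
      isClopen' := (isClopen_discrete {true}).preimage (continuous_apply a)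
      upper' := fun _ _ hpq => le_iff.1 hpq a }
  map_sup' a b := ClopenUpperSet.ext <| Set.ext fun p => show p (a ⊔ b) ↔ p a ∨ p b by simp
  map_inf' a b := ClopenUpperSet.ext <| Set.ext fun p => show p (a ⊓ b) ↔ p a ∧ p b by simp
  map_top' := by ext p; simp
  map_bot' := by ext p; simp

theorem exists_mem_basicClopen_of_not_le {p q : PriestleyDual A} (hpq : ¬p ≤ q) :
    ∃ a, p ∈ basicClopen a ∧ q ∉ basicClopen a := by
  rw [le_iff] at hpq
  push Not at hpq
  exact hpq

instance : PriestleySpace (PriestleyDual A) where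
  priestley hpq :=
    let ⟨a, hp, hq⟩ := exists_mem_basicClopen_of_not_le hpq
    ⟨basicClopen a, (basicClopen a).isClopen, (basicClopen a).upper, hp, hq⟩

theorem basicClopen_surjective :
    Function.Surjective (basicClopen : BoundedLatticeHom A (ClopenUpperSet (PriestleyDual A))) :=
  surjective_of_forall_not_le_exists_mem _ fun _ _ => exists_mem_basicClopen_of_not_le

open Classical in
/-- The prime filter complementary to a prime ideal. -/
noncomputable def ofPrimeIdeal (J : Order.Ideal A) (hJ : J.IsPrime) : PriestleyDual A :=
  ({ toFun a := decide (a ∉ J)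
     map_sup' a b := by simp [Order.Ideal.sup_mem_iff, imp_iff_not_or]
     map_inf' a b := by
      have inf_mem_iff : a ⊓ b ∈ J ↔ a ∈ J ∨ b ∈ J :=
        ⟨hJ.mem_or_mem, fun h => h.elim (J.lower inf_le_left) (J.lower inf_le_right)⟩
      simp [inf_mem_iff]
     map_top' := by simpa using hJ.toIsProper.top_notMem
     map_bot' := by simp } : BoundedLatticeHom A Bool)

theorem ofPrimeIdeal_apply {J : Order.Ideal A} {hJ : J.IsPrime} {a : A} :
    ofPrimeIdeal J hJ a ↔ a ∉ J := by
  classical exact decide_eq_true_iff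

end Lattice

section DistribLattice

variable {A : Type*} [DistribLattice A] [BoundedOrder A]

theorem exists_forall_apply_and_not_apply {F : Order.PFilter A} {b : A} (hb : b ∉ F) :
    ∃ p : PriestleyDual A, (∀ a ∈ F, p a) ∧ ¬p b := by
  have disjoint : Disjoint (F : Set A) (Order.Ideal.principal b : Order.Ideal A) :=
    disjoint_left.2 fun a ha hab => hb (Order.PFilter.mem_of_le hab ha)
  obtain ⟨J, hJ, hbJ, hFJ⟩ := DistribLattice.prime_ideal_of_disjoint_filter_ideal disjoint
  exact ⟨ofPrimeIdeal J hJ, fun a ha => ofPrimeIdeal_apply.2 (disjoint_left.1 hFJ ha),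
    fun h => ofPrimeIdeal_apply.1 h (hbJ Order.Ideal.mem_principal_self)⟩

theorem exists_apply_and_not_apply_of_not_le {a b : A} (hab : ¬a ≤ b) :
    ∃ p : PriestleyDual A, p a ∧ ¬p b :=
  let ⟨p, hp, hpb⟩ := exists_forall_apply_and_not_apply (F := .principal a) hab
  ⟨p, hp a le_rfl, hpb⟩

instance [Nontrivial A] : Nonempty (PriestleyDual A) :=
  (exists_apply_and_not_apply_of_not_le (bot_lt_top (α := A)).not_ge).nonempty

variable (A) in
/-- Priestley's representation of a bounded distributive lattice by the clopen upper sets of its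
dual. -/
noncomputable def basicClopenOrderIso : A ≃o ClopenUpperSet (PriestleyDual A) :=
  RelIso.ofSurjective (OrderEmbedding.ofMapLEIff basicClopen fun _ _ =>
    ⟨fun h => by_contra fun hab =>
      let ⟨_, ha, hb⟩ := exists_apply_and_not_apply_of_not_le hab
      hb (h ha), fun h => OrderHomClass.mono basicClopen h⟩) basicClopen_surjective

end DistribLattice

theorem himp_apply {A : Type*} [HeytingAlgebra A] {p : PriestleyDual A} {a b : A} :
    p (a ⇨ b) ↔ ∀ q, p ≤ q → q a → q b := by
  refine ⟨fun h q hpq ha => ?_, fun h => by_contra fun hp => ?_⟩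
  · refine q.apply_of_le (himp_inf_le (a := a)) ?_
    rw [map_inf, le_iff.1 hpq _ h, ha]
    rfl
  have isPFilter : Order.IsPFilter {c | p (a ⇨ c)} := by
    refine .of_def ⟨⊤, by simp⟩ ?_ fun hcd hc => p.apply_of_le (himp_le_himp_left hcd) hc
    exact fun c hc d hd => ⟨c ⊓ d, by simpa [himp_inf_distrib] using ⟨hc, hd⟩, inf_le_left,
      inf_le_right⟩
  obtain ⟨q, hq, hqb⟩ := exists_forall_apply_and_not_apply (F := isPFilter.toPFilter) (b := b) hp
  refine hqb (h q (le_iff.2 fun c hc => hq c (p.apply_of_le le_himp hc)) (hq a ?_))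
  change p (a ⇨ a)
  simp

/-! ### Points of a compact Priestley space -/

section ClopenUpperSet

variable {α : Type*} [TopologicalSpace α]

open Classical in
/-- The prime filter of clopen upper sets containing a given point. -/
noncomputable def ofPoint [LE α] (x : α) : PriestleyDual (ClopenUpperSet α) :=
  ({ toFun U := decide (x ∈ U)
     map_sup' U V := by simp [← SetLike.mem_coe]
     map_inf' U V := by simp [← SetLike.mem_coe]
     map_top' := by simp [← SetLike.mem_coe]
     map_bot' := by simp [← SetLike.mem_coe] } : BoundedLatticeHom (ClopenUpperSet α) Bool)

theorem ofPoint_apply [LE α] {x : α} {U : ClopenUpperSet α} : ofPoint x U ↔ x ∈ U := by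
  classical exact decide_eq_true_iff

theorem exists_sdiff_subset [LE α] [CompactSpace α] (p : PriestleyDual (ClopenUpperSet α))
    {O : Set α} (hO : IsOpen O) (h : ∀ x, ofPoint x = p → x ∈ O) :
    ∃ U V : ClopenUpperSet α, p U ∧ ¬p V ∧ (U \ V : Set α) ⊆ O := by
  -- The closed sets `U \ V` with `p U` and `¬p V` are directed, and the points in their
  -- intersection are exactly those representing `p`.
  let ι := {i : ClopenUpperSet α × ClopenUpperSet α // p i.1 ∧ ¬p i.2}
  have : Nonempty ι := ⟨(⊤, ⊥), by simp⟩
  have directed : Directed (· ⊇ ·) fun i : ι => (i.1.1 \ i.1.2 : Set α) := by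
    rintro ⟨⟨U, V⟩, hU, hV⟩ ⟨⟨U', V'⟩, hU', hV'⟩
    exact ⟨⟨(U ⊓ U', V ⊔ V'), by simp_all⟩,
      sdiff_subset_sdiff inter_subset_left subset_union_left,
      sdiff_subset_sdiff inter_subset_right subset_union_right⟩
  have mem_nhds : ∀ x ∈ ⋂ i : ι, (i.1.1 \ i.1.2 : Set α), O ∈ nhds x := by
    refine fun x hx => hO.mem_nhds (h x (DFunLike.ext _ _ fun U => Bool.eq_iff_iff.2 ?_))
    rw [ofPoint_apply]
    constructor
    · exact fun hxU => by_contra fun hU => (mem_iInter.1 hx ⟨(⊤, U), by simp, hU⟩).2 hxU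
    · exact fun hU => (mem_iInter.1 hx ⟨(U, ⊥), hU, by simp⟩).1
  obtain ⟨⟨⟨U, V⟩, hU, hV⟩, hUV⟩ := exists_subset_nhds_of_compactSpace directed
    (fun i => i.1.1.isClopen.isClosed.sdiff i.1.2.isClopen.isOpen) mem_nhds
  exact ⟨U, V, hU, hV, hUV⟩

theorem ofPoint_surjective [LE α] [CompactSpace α] :
    Function.Surjective (ofPoint : α → PriestleyDual (ClopenUpperSet α)) := by
  intro p
  by_contra! hp
  obtain ⟨U, V, hU, hV, hUV⟩ := p.exists_sdiff_subset isOpen_empty fun x hx => hp x hx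
  exact hV (p.apply_of_le (sdiff_eq_empty.1 (subset_empty_iff.1 hUV)) hU)

theorem ofPoint_injective [PartialOrder α] [PriestleySpace α] :
    Function.Injective (ofPoint : α → PriestleyDual (ClopenUpperSet α)) := fun x y h =>
  eq_of_forall_mem_clopenUpperSet_iff fun U => by rw [← ofPoint_apply, h, ofPoint_apply]

end ClopenUpperSet

end PriestleyDual

theorem isTopologicalBasis_clopenUpperSet_sdiff {α : Type*} [TopologicalSpace α] [PartialOrder α]
    [PriestleySpace α] [CompactSpace α] :
    IsTopologicalBasis (range fun U : ClopenUpperSet α × ClopenUpperSet α =>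
      (U.1 \ U.2 : Set α)) := by
  refine isTopologicalBasis_of_isOpen_of_nhds ?_ fun x O hx hO => ?_
  · rintro _ ⟨⟨U, V⟩, rfl⟩
    exact (U.isClopen.diff V.isClopen).isOpen
  · obtain ⟨U, V, hU, hV, hUV⟩ := (PriestleyDual.ofPoint x).exists_sdiff_subset hO
      fun y hy => PriestleyDual.ofPoint_injective hy ▸ hx
    rw [PriestleyDual.ofPoint_apply] at hU hV
    exact ⟨_, ⟨(U, V), rfl⟩, ⟨hU, hV⟩, hUV⟩

theorem exists_continuous_monotone_mem_iff {α β : Type*} [TopologicalSpace α] [Preorder α]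
    [TopologicalSpace β] [PartialOrder β] [PriestleySpace β] [CompactSpace β]
    (h : BoundedLatticeHom (ClopenUpperSet β) (ClopenUpperSet α)) :
    ∃ f : α → β, Continuous f ∧ Monotone f ∧ ∀ x U, f x ∈ U ↔ x ∈ h U := by
  choose f hf using fun x => PriestleyDual.ofPoint_surjective
    ((PriestleyDual.ofPoint x : BoundedLatticeHom _ Bool).comp h)
  have mem_iff (x U) : f x ∈ U ↔ x ∈ h U := by
    rw [← PriestleyDual.ofPoint_apply, hf]
    exact PriestleyDual.ofPoint_apply
  refine ⟨f, isTopologicalBasis_clopenUpperSet_sdiff.continuous_iff.2 ?_, fun x y hxy => ?_,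
    mem_iff⟩
  · rintro _ ⟨⟨U, V⟩, rfl⟩
    have preimage_eq : f ⁻¹' (U \ V : Set β) = (h U : Set α) \ h V := by
      ext x
      exact and_congr (mem_iff x U) (mem_iff x V).not
    rw [preimage_eq]
    exact ((h U).isClopen.diff (h V).isClopen).isOpen
  · exact le_of_forall_mem_clopenUpperSet fun U hU =>
      (mem_iff y U).2 ((h U).upper hxy ((mem_iff x U).1 hU))

/-! ### Esakia spaces -/

/-- An Esakia space: a Priestley space in which the down-set generated by a clopen set is clopen,
so that its clopen upper sets form a Heyting algebra. As for `PriestleySpace`, compactness is a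
separate assumption. -/
class EsakiaSpace (α : Type*) [TopologicalSpace α] [PartialOrder α] : Prop
    extends PriestleySpace α where
  isClopen_lowerClosure {U : Set α} : IsClopen U → IsClopen (lowerClosure U : Set α)

namespace EsakiaSpace

theorem of_isClopen_lowerClosure_sdiff {α : Type*} [TopologicalSpace α] [PartialOrder α]
    [PriestleySpace α] [CompactSpace α]
    (h : ∀ U V : ClopenUpperSet α, IsClopen (lowerClosure (U \ V : Set α) : Set α)) :
    EsakiaSpace α where
  isClopen_lowerClosure {O} hO := by
    obtain ⟨s, hs, rfl⟩ := eq_finite_iUnion_of_isTopologicalBasis_of_isCompact_open _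
      isTopologicalBasis_clopenUpperSet_sdiff O hO.isClosed.isCompact hO.isOpen
    simp only [lowerClosure_iUnion, LowerSet.coe_iSup]
    exact hs.isClopen_biUnion fun i _ => h i.1 i.2

variable {α β : Type*} [TopologicalSpace α] [PartialOrder α] [TopologicalSpace β] [PartialOrder β]

section HeytingAlgebra

variable [EsakiaSpace α]

instance : HImp (ClopenUpperSet α) where
  himp U V :=
    { carrier := (lowerClosure (U \ V : Set α))ᶜ
      isClopen' := (isClopen_lowerClosure (U.isClopen.diff V.isClopen)).compl
      upper' := (lowerClosure (U \ V : Set α)).lower.compl }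

theorem mem_himp {U V : ClopenUpperSet α} {x : α} :
    x ∈ U ⇨ V ↔ ∀ y, x ≤ y → y ∈ U → y ∈ V := by
  change x ∉ lowerClosure (U \ V : Set α) ↔ _
  rw [mem_lowerClosure]
  push Not
  exact ⟨fun h y hxy hU => by_contra fun hV => h y ⟨hU, hV⟩ hxy,
    fun h y hy hxy => hy.2 (h y hxy hy.1)⟩

instance : HeytingAlgebra (ClopenUpperSet α) where
  le_top _ := le_top
  bot_le _ := bot_le
  le_himp_iff _ _ _ := ⟨fun h _ hx => mem_himp.1 (h hx.1) _ le_rfl hx.2,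
    fun h _ hx => mem_himp.2 fun _ hxy hy => h ⟨ClopenUpperSet.upper _ hxy hx, hy⟩⟩
  compl U := U ⇨ ⊥
  himp_bot _ := rfl

end HeytingAlgebra

section comap

variable [EsakiaSpace α] [EsakiaSpace β]

/-- The preimage of clopen upper sets under an Esakia morphism, as a Heyting homomorphism. -/
def comap (f : EsakiaHom α β) : HeytingHom (ClopenUpperSet β) (ClopenUpperSet α) where
  toFun U :=
    { carrier := f ⁻¹' U
      isClopen' := U.isClopen.preimage (map_continuous f)
      upper' := U.upper.preimage (OrderHomClass.mono f) }
  map_sup' _ _ := rfl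
  map_inf' _ _ := rfl
  map_bot' := rfl
  map_himp' U V := by
    have map_mem_himp_iff (x : α) : f x ∈ U ⇨ V ↔ ∀ y, x ≤ y → f y ∈ U → f y ∈ V := by
      rw [mem_himp]
      refine ⟨fun h y hxy => h _ (OrderHomClass.mono f hxy), fun h z hz => ?_⟩
      obtain ⟨y, hxy, rfl⟩ := EsakiaHomClass.exists_map_eq_of_map_le f hz
      exact h y hxy
    refine SetLike.ext fun x => (map_mem_himp_iff x).trans (Iff.symm ?_)
    exact mem_himp

theorem mem_comap {f : EsakiaHom α β} {U : ClopenUpperSet β} {x : α} :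
    x ∈ comap f U ↔ f x ∈ U := Iff.rfl

theorem comap_injective :
    Function.Injective (comap : EsakiaHom α β → HeytingHom _ (ClopenUpperSet α)) := fun f g h =>
  DFunLike.ext _ _ fun x => eq_of_forall_mem_clopenUpperSet_iff fun U => by
    rw [← mem_comap, h, mem_comap]

end comap

theorem exists_map_eq_of_map_le [EsakiaSpace α] [CompactSpace α] [EsakiaSpace β] [CompactSpace β]
    {h : HeytingHom (ClopenUpperSet β) (ClopenUpperSet α)} {f : α → β} (hf : Continuous f)
    (mem_iff : ∀ x U, f x ∈ U ↔ x ∈ h U) {x : α} {y : β} (hxy : f x ≤ y) :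
    ∃ z, x ≤ z ∧ f z = y := by
  by_contra hy
  have isClosed_image : IsClosed (f '' Ici x) := (isClosed_Ici.isCompact.image hf).isClosed
  obtain ⟨_, ⟨⟨U, V⟩, rfl⟩, ⟨hyU, hyV⟩, hUV⟩ :=
    isTopologicalBasis_clopenUpperSet_sdiff.exists_subset_of_mem_open hy isClosed_image.isOpen_compl
  have hx : x ∈ h (U ⇨ V) := by
    rw [map_himp, mem_himp]
    intro z hxz hzU
    rw [← mem_iff] at hzU ⊢
    by_contra hzV
    exact hUV ⟨hzU, hzV⟩ ⟨z, hxz, rfl⟩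
  exact hyV (mem_himp.1 ((mem_iff x _).2 hx) y hxy hyU)

theorem comap_surjective [EsakiaSpace α] [CompactSpace α] [EsakiaSpace β] [CompactSpace β] :
    Function.Surjective (comap : EsakiaHom α β → HeytingHom _ (ClopenUpperSet α)) := by
  intro h
  obtain ⟨f, hcont, hmono, mem_iff⟩ := exists_continuous_monotone_mem_iff (α := α) (β := β) h
  exact ⟨⟨⟨⟨f, hmono⟩, hcont⟩, fun _ _ => exists_map_eq_of_map_le hcont mem_iff⟩,
    DFunLike.ext _ _ fun U => ClopenUpperSet.ext <| Set.ext fun x => mem_iff x U⟩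

end EsakiaSpace

instance {A : Type*} [HeytingAlgebra A] : EsakiaSpace (PriestleyDual A) :=
  EsakiaSpace.of_isClopen_lowerClosure_sdiff fun U V => by
    obtain ⟨a, rfl⟩ := PriestleyDual.basicClopen_surjective U
    obtain ⟨b, rfl⟩ := PriestleyDual.basicClopen_surjective V
    convert (PriestleyDual.basicClopen (a ⇨ b)).isClopen.compl using 1
    ext p
    change p ∈ lowerClosure _ ↔ ¬p (a ⇨ b)
    rw [PriestleyDual.himp_apply, mem_lowerClosure]
    push Not
    exact ⟨fun ⟨q, ⟨ha, hb⟩, hpq⟩ => ⟨q, hpq, ha, hb⟩, fun ⟨q, hpq, ha, hb⟩ => ⟨q, ⟨ha, hb⟩, hpq⟩⟩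

/-! ### Intuitionistic powers as Heyting algebras -/

theorem IntPower.val_injective {L : Type v} {W : Type u} [Preorder L] [PartialOrder W] :
    Function.Injective (val : IntPower L W → W → L) := by
  rintro ⟨_, _⟩ ⟨_, _⟩ rfl
  rfl

section IntPower

variable {L : Type v} [DistribLattice L] [BoundedOrder L] [Finite L]

theorem le_finImp_iff {a b c : L} : c ≤ finImp a b ↔ c ⊓ a ≤ b := by
  rw [inf_comm]
  refine ⟨fun h => (inf_le_inf_left a h).trans ?_, fun h => (isLUB_finJoin _).1 h⟩
  simp [finImp, finJoin, Finset.sup_inf_distrib_left]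

namespace IntPower

variable {W : Type u} [PartialOrder W]

theorem le_himp_val_iff {f g h : IntPower L W} : f.val ≤ (g ⇨ h).val ↔ f.val ⊓ g.val ≤ h.val := by
  constructor
  · intro hf w
    exact le_finImp_iff.1 ((hf w).trans ((isGLB_finMeet _).1 ⟨w, le_rfl, rfl⟩))
  · intro hf w
    refine (isGLB_finMeet _).2 ?_
    rintro _ ⟨w', hw, rfl⟩
    exact le_finImp_iff.2 ((inf_le_inf_right _ (f.mono hw)).trans (hf w'))

noncomputable instance : HeytingAlgebra (IntPower L W) where
  __ := PartialOrder.lift (val : IntPower L W → W → L) val_injective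
  __ := IntPower.instImpAlg L W
  sup f g := f ⊔ g
  inf f g := f ⊓ g
  le_sup_left f _ w := le_sup_left (a := f.val w)
  le_sup_right f _ w := le_sup_right (a := f.val w)
  sup_le _ _ _ h₁ h₂ w := sup_le (h₁ w) (h₂ w)
  inf_le_left f _ w := inf_le_left (a := f.val w)
  inf_le_right f _ w := inf_le_right (a := f.val w)
  le_inf _ _ _ h₁ h₂ w := le_inf (h₁ w) (h₂ w)
  le_top f w := le_top (a := f.val w)
  bot_le f w := bot_le (a := f.val w)
  le_himp_iff _ _ _ := le_himp_val_iff
  compl f := f ⇨ ⊥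
  himp_bot _ := rfl

end IntPower

/-- The copy `{⊥, ⊤}` of the two-element lattice in a bounded lattice. -/
def boolHom (L : Type*) [Lattice L] [BoundedOrder L] : BoundedLatticeHom Bool L where
  toFun b := bif b then ⊤ else ⊥
  map_sup' := by rintro (_ | _) (_ | _) <;> simp
  map_inf' := by rintro (_ | _) (_ | _) <;> simp
  map_top' := rfl
  map_bot' := rfl

namespace PriestleyDual

variable {A : Type u} [HeytingAlgebra A]

/-- The indicator function of `a` in the intuitionistic power over the prime filters, equal to `⊤`
at those containing `a` and to `⊥` at all others. -/
noncomputable def indicator (a : A) : IntPower L (PriestleyDual A) where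
  val p := boolHom L (p a)
  mono _ _ hpq := OrderHomClass.mono (boolHom L) (hpq a)

theorem indicator_himp (a b : A) :
    (indicator (a ⇨ b) : IntPower L (PriestleyDual A)) = indicator a ⇨ indicator b := by
  refine le_antisymm (le_himp_iff.2 fun p => ?_) fun p => ?_
  · change boolHom L (p (a ⇨ b)) ⊓ boolHom L (p a) ≤ boolHom L (p b)
    rw [← map_inf, ← map_inf]
    exact OrderHomClass.mono (boolHom L) (OrderHomClass.mono p himp_inf_le)
  · change _ ≤ boolHom L (p (a ⇨ b))
    by_cases hp : p (a ⇨ b)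
    · exact le_top.trans_eq (congrArg (boolHom L) hp).symm
    rw [himp_apply] at hp
    push Not at hp
    obtain ⟨q, hpq, ha, hb⟩ := hp
    let f : IntPower L (PriestleyDual A) := indicator a
    let g : IntPower L (PriestleyDual A) := indicator b
    calc (f ⇨ g).val p
        ≤ (f ⇨ g).val q := (f ⇨ g).mono hpq
      _ = (f ⇨ g).val q ⊓ f.val q :=
        ((congrArg _ (congrArg (boolHom L) ha)).trans (inf_top_eq _)).symm
      _ ≤ g.val q := himp_inf_le (a := f) q
      _ = ⊥ := congrArg (boolHom L) (Bool.eq_false_of_not_eq_true hb)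
      _ ≤ _ := bot_le

variable (L A) in
/-- A Heyting algebra as a subalgebra of an intuitionistic power of `L`, through the indicator
functions. -/
noncomputable def toIntPower : HeytingHom A (IntPower L (PriestleyDual A)) where
  toFun := indicator
  map_sup' a b := IntPower.val_injective <| funext fun p =>
    (congrArg (boolHom L) (map_sup p a b)).trans (map_sup (boolHom L) _ _)
  map_inf' a b := IntPower.val_injective <| funext fun p =>
    (congrArg (boolHom L) (map_inf p a b)).trans (map_inf (boolHom L) _ _)
  map_bot' := IntPower.val_injective <| funext fun p => congrArg (boolHom L) (map_bot p)
  map_himp' := indicator_himp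

theorem toIntPower_injective [Nontrivial L] : Function.Injective (toIntPower L A) := by
  have boolHom_injective : Function.Injective (boolHom L) := by
    rintro (_ | _) (_ | _) <;> simp [boolHom]
  have le_of_eq {a b : A} (hab : toIntPower L A a = toIntPower L A b) : a ≤ b := by
    by_contra hle
    obtain ⟨p, ha, hb⟩ := exists_apply_and_not_apply_of_not_le hle
    exact hb (boolHom_injective (congrFun (congrArg IntPower.val hab) p) ▸ ha)
  exact fun a b hab => le_antisymm (le_of_eq hab) (le_of_eq hab.symm)

end PriestleyDual

end IntPower

/-! ### The algebras in `ISP_I(L)` -/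

/-- The underlying algebra of a Heyting algebra. -/
abbrev ImpAlg.ofHeytingAlgebra (A : Type u) [HeytingAlgebra A] : ImpAlg A where

/-- The range of a homomorphism. -/
def ImpAlgHom.range {A : Type u} {B : Type v} [ImpAlg A] [ImpAlg B] (f : ImpAlgHom A B) :
    ImpSubalg B where
  carrier := Set.range f.toFun
  sup_mem := by rintro _ _ ⟨a, rfl⟩ ⟨b, rfl⟩; exact ⟨a ⊔ b, f.map_sup a b⟩
  inf_mem := by rintro _ _ ⟨a, rfl⟩ ⟨b, rfl⟩; exact ⟨a ⊓ b, f.map_inf a b⟩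
  himp_mem := by rintro _ _ ⟨a, rfl⟩ ⟨b, rfl⟩; exact ⟨a ⇨ b, f.map_himp a b⟩
  top_mem := ⟨⊤, f.map_top⟩
  bot_mem := ⟨⊥, f.map_bot⟩

section ISPI

variable {L : Type v} [DistribLattice L] [BoundedOrder L] [Finite L]

theorem isISPI_iff_exists_injective {A : Type u} [ImpAlg A] :
    IsISPI L A ↔ ∃ (W : Type u) (_ : PartialOrder W) (_ : Nonempty W)
      (f : ImpAlgHom A (IntPower L W)), Function.Injective f.toFun := by
  constructor
  · rintro ⟨W, _, hW, B, e, he⟩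
    exact ⟨W, _, hW,
      { toFun a := (e.toFun a).1
        map_sup a b := congrArg Subtype.val (e.map_sup a b)
        map_inf a b := congrArg Subtype.val (e.map_inf a b)
        map_himp a b := congrArg Subtype.val (e.map_himp a b)
        map_top := congrArg Subtype.val e.map_top
        map_bot := congrArg Subtype.val e.map_bot }, Subtype.val_injective.comp he.1⟩
  · rintro ⟨W, _, hW, f, hf⟩
    exact ⟨W, _, hW, f.range,
      { toFun a := ⟨f.toFun a, a, rfl⟩
        map_sup a b := Subtype.ext (f.map_sup a b)
        map_inf a b := Subtype.ext (f.map_inf a b)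
        map_himp a b := Subtype.ext (f.map_himp a b)
        map_top := Subtype.ext f.map_top
        map_bot := Subtype.ext f.map_bot },
      fun _ _ h => hf (congrArg Subtype.val h), fun ⟨_, a, ha⟩ => ⟨a, Subtype.ext ha⟩⟩

theorem IsISPI.exists_ofHeytingAlgebra {A : Type u} {alg : ImpAlg A} (hA : IsISPI L A) :
    ∃ _ : HeytingAlgebra A, ImpAlg.ofHeytingAlgebra A = alg := by
  obtain ⟨W, _, _, f, hf⟩ := isISPI_iff_exists_injective.1 hA
  let : LE A := ⟨fun a b => f.toFun a ≤ f.toFun b⟩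
  let : LT A := ⟨fun a b => f.toFun a < f.toFun b⟩
  let : Compl A := ⟨fun a => a ⇨ ⊥⟩
  exact ⟨hf.heytingAlgebra f.toFun Iff.rfl Iff.rfl f.map_sup f.map_inf f.map_top f.map_bot
    (fun a => (f.map_himp a ⊥).trans (by rw [f.map_bot]; exact himp_bot _)) f.map_himp, rfl⟩

theorem IsISPI.nontrivial [Nontrivial L] {A : Type u} [ImpAlg A] (hA : IsISPI L A) :
    Nontrivial A := by
  obtain ⟨W, _, ⟨w⟩, f, -⟩ := isISPI_iff_exists_injective.1 hA
  refine ⟨⊤, ⊥, fun h => top_ne_bot (α := L) ?_⟩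
  have map_top_eq_map_bot : (⊤ : IntPower L W) = ⊥ := by rw [← f.map_top, h, f.map_bot]
  exact congrArg (fun g => IntPower.val g w) map_top_eq_map_bot

theorem isISPI_ofHeytingAlgebra [Nontrivial L] (A : Type u) [HeytingAlgebra A] [Nontrivial A] :
    @IsISPI L _ _ _ A (.ofHeytingAlgebra A) := by
  let := ImpAlg.ofHeytingAlgebra A
  let f := PriestleyDual.toIntPower L A
  exact isISPI_iff_exists_injective.2 ⟨PriestleyDual A, inferInstance, inferInstance,
    { toFun := f
      map_sup := map_sup f
      map_inf := map_inf f
      map_himp := map_himp f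
      map_top := map_top f
      map_bot := map_bot f }, PriestleyDual.toIntPower_injective⟩

end ISPI

namespace ISPI

variable (L : Type v) [DistribLattice L] [BoundedOrder L] [Finite L] [Nontrivial L]

/-- A nontrivial Heyting algebra as an object of `ISP_I(L)`. -/
def of (A : Type u) [HeytingAlgebra A] [Nontrivial A] : ISPI.{u, v} L :=
  @ISPI.mk L _ _ _ A (.ofHeytingAlgebra A) (isISPI_ofHeytingAlgebra A)

theorem exists_of_eq (A : ISPI.{u, v} L) :
    ∃ (B : Type u) (_ : HeytingAlgebra B) (_ : Nontrivial B), of L B = A := by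
  obtain ⟨A, hA⟩ := A
  obtain ⟨_, rfl⟩ := hA.exists_ofHeytingAlgebra
  let := ImpAlg.ofHeytingAlgebra A
  exact ⟨A, _, hA.nontrivial, rfl⟩

variable {A B : Type u} [HeytingAlgebra A] [Nontrivial A] [HeytingAlgebra B] [Nontrivial B]

/-- Arrows of `ISP_I(L)` between Heyting algebras are Heyting homomorphisms. -/
def homEquiv : HeytingHom A B ≃ (of L A ⟶ of L B) where
  toFun f :=
    letI := ImpAlg.ofHeytingAlgebra A
    letI := ImpAlg.ofHeytingAlgebra B
    { toFun := f
      map_sup := map_sup f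
      map_inf := map_inf f
      map_himp := map_himp f
      map_top := map_top f
      map_bot := map_bot f : ImpAlgHom A B }
  invFun f :=
    { toFun := f.toFun
      map_sup' := f.map_sup
      map_inf' := f.map_inf
      map_himp' := f.map_himp
      map_bot' := f.map_bot }
  left_inv _ := rfl
  right_inv _ := rfl

/-- Isomorphic Heyting algebras are isomorphic in `ISP_I(L)`. -/
def isoOfOrderIso (e : A ≃o B) : of L A ≅ of L B where
  hom := homEquiv L e
  inv := homEquiv L e.symm
  hom_inv_id := ImpAlgHom.ext (funext e.symm_apply_apply)
  inv_hom_id := ImpAlgHom.ext (funext e.apply_symm_apply)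

end ISPI

/-! ### The duality -/

instance (S : PSpa.{u}) : Nonempty S.carrier := S.nonempty

instance (S : PSpa.{u}) : CompactSpace S.carrier := S.compact

instance (S : HSpa.{u}) : EsakiaSpace S.carrier where
  priestley := S.separated _ _
  isClopen_lowerClosure hU := (S.clopen_down _ hU).1

instance {α : Type*} [TopologicalSpace α] [PartialOrder α] [Nonempty α] :
    Nontrivial (ClopenUpperSet α) :=
  let ⟨x⟩ := ‹Nonempty α›
  ⟨⊤, ⊥, fun h => (h ▸ trivial : x ∈ (⊥ : ClopenUpperSet α))⟩

namespace HSpa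

/-- A nonempty compact Esakia space as an object of `HSpa`. -/
def of (α : Type u) [TopologicalSpace α] [PartialOrder α] [Nonempty α] [CompactSpace α]
    [EsakiaSpace α] : HSpa.{u} where
  carrier := α
  nonempty := inferInstance
  compact := inferInstance
  separated _ _ := exists_isClopen_upper_of_not_le
  clopen_down U hU := ⟨EsakiaSpace.isClopen_lowerClosure hU, (lowerClosure U).lower⟩

variable (L : Type v) [DistribLattice L] [BoundedOrder L] [Finite L] [Nontrivial L]

/-- The contravariant functor sending an Esakia space to the Heyting algebra of its clopen upper
sets. -/
def clopenUpperSets : HSpa.{u} ⥤ (ISPI.{u, v} L)ᵒᵖ where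
  obj S := .op (ISPI.of L (ClopenUpperSet S.carrier))
  map f := (ISPI.homEquiv L (EsakiaSpace.comap f)).op
  map_id _ := rfl
  map_comp _ _ := rfl

instance : (clopenUpperSets.{u} L).Faithful where
  map_injective h :=
    EsakiaSpace.comap_injective ((ISPI.homEquiv L).injective (Quiver.Hom.op_inj h))

instance : (clopenUpperSets.{u} L).Full where
  map_surjective g := by
    obtain ⟨h, hg⟩ := (ISPI.homEquiv L).surjective g.unop
    obtain ⟨f, rfl⟩ := EsakiaSpace.comap_surjective h
    exact ⟨f, Quiver.Hom.unop_inj hg⟩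

instance : (clopenUpperSets.{u} L).EssSurj where
  mem_essImage Y := by
    obtain ⟨A, _, _, hA⟩ := ISPI.exists_of_eq L Y.unop
    have iso := ISPI.isoOfOrderIso L (PriestleyDual.basicClopenOrderIso A)
    rw [hA] at iso
    exact ⟨of (PriestleyDual A), ⟨iso.op⟩⟩

end HSpa

theorem theoremD22 (L : Type v) [DistribLattice L] [BoundedOrder L] [Finite L] [Nontrivial L] :
    Nonempty ((ISPI.{u, v} L)ᵒᵖ ≌ HSpa.{u}) := by
  have : (HSpa.clopenUpperSets.{u} L).IsEquivalence := {}
  exact ⟨(HSpa.clopenUpperSets.{u} L).asEquivalence.symm⟩
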